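/- For a topological space $X$, let the weight $w(X)$ be the least cardinality of a base of $X$. A family $\mathcal B$ of open sets of $X$ is a $\pi$-base if every non-empty open set contains a non-empty member of $\mathcal B$; the $\pi$-weight $\pi w(X)$ is the least cardinality of a $\pi$-base of $X$. A space is zero-dimensional if its clopen sets form a base. A continuous map $f\colon E\to X$ is irreducible if $f(E)=X$ and $f(A)\neq X$ for every proper closed subset $A$ of $E$; it is perfect if it is closed and has compact fibres. An absolute of a regular Hausdorff space $X$ is an extremally disconnected Tychonoff space $E$ for which there is a perfect irreducible map $E\to X$. Two regular Hausdorff spaces are co-absolute if they have homeomorphic absolutes. Theorem. Let $X$ be a compact Hausdorff space. (1) Let $\tau$ be an infinite cardinal. If $\pi w(X)=\tau$, then $X$ is co-absolute with a zero-dimensional compact Hausdorff space $Y$ with $w(Y)=\tau$. (2) (Ponomarev) $X$ is co-absolute with a compact metrizable space if and only if $\pi w(X)\le\aleph_0$. -/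

import Mathlib

open Cardinal TopologicalSpace

universe u v

/-- The weight `w(X)`: the least cardinality of a base of `X`. -/
noncomputable def topWeight (X : Type u) [TopologicalSpace X] : Cardinal.{u} :=
  sInf {c : Cardinal.{u} | ∃ B : Set (Set X), IsTopologicalBasis B ∧ #B = c}

/-- A family of open sets is a π-base of `X` if every non-empty open set contains a non-empty
member of the family. -/
def IsPiBase {X : Type u} [TopologicalSpace X] (B : Set (Set X)) : Prop :=
  (∀ V ∈ B, IsOpen V) ∧
    ∀ U : Set X, IsOpen U → U.Nonempty → ∃ V ∈ B, V.Nonempty ∧ V ⊆ U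

/-- The π-weight `πw(X)`: the least cardinality of a π-base of `X`. -/
noncomputable def piWeight (X : Type u) [TopologicalSpace X] : Cardinal.{u} :=
  sInf {c : Cardinal.{u} | ∃ B : Set (Set X), IsPiBase B ∧ #B = c}

/-- A space is zero-dimensional if its clopen sets form a base. -/
def IsZeroDimensional (X : Type u) [TopologicalSpace X] : Prop :=
  IsTopologicalBasis {s : Set X | IsClopen s}

/-- A continuous map is irreducible if it is onto and maps no proper closed subset onto the
codomain. -/
def IsIrreducibleMap {X : Type u} {Y : Type v} [TopologicalSpace X] [TopologicalSpace Y]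
    (f : X → Y) : Prop :=
  Continuous f ∧ f.Surjective ∧ ∀ A : Set X, IsClosed A → A ≠ Set.univ → f '' A ≠ Set.univ

/-- `E` is an absolute of the (regular) space `X`: an extremally disconnected Tychonoff space
with a perfect irreducible map onto `X`. (A map is perfect, i.e. continuous and closed with
compact fibres, iff it is an `IsProperMap`: `isProperMap_iff_isClosedMap_and_compact_fibers`.) -/
def IsAbsolute (E : Type u) (X : Type v) [TopologicalSpace E] [TopologicalSpace X] : Prop :=
  T35Space E ∧ ExtremallyDisconnected E ∧ ∃ f : E → X, IsProperMap f ∧ IsIrreducibleMap f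

/-- Two (regular) spaces are co-absolute if they have homeomorphic absolutes. -/
def CoAbsolute (X : Type u) (Y : Type v) [TopologicalSpace X] [TopologicalSpace Y] : Prop :=
  ∃ (E : Type u) (_ : TopologicalSpace E) (F : Type v) (_ : TopologicalSpace F),
    IsAbsolute E X ∧ IsAbsolute F Y ∧ Nonempty (E ≃ₜ F)

/-! Let `f : E → X` be a compact absolute. Closed irreducible maps preserve π-weight, so π-weight is
a co-absolute invariant; with `piWeight ≤ topWeight` this gives the lower bound on the weight in (1)
and necessity in (2). Conversely, let `B` be a π-base of `X`. The closures of the sets `f ⁻¹' V`, `V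
∈ B`, are clopen in `E`, and their indicators map `E` onto a subspace `Y` of the Cantor cube `B →
Bool`. These preimages form a π-base of `E`, which makes `E → Y` irreducible: `E` is an absolute of
both `X` and `Y`. -/

/-- A self-map over an irreducible map is the identity. -/
theorem IsIrreducibleMap.eq_id_of_comp_eq {E X : Type*} [TopologicalSpace E] [TopologicalSpace X]
    [T2Space E] {f : E → X} (hf : IsIrreducibleMap f) {h : E → E} (hh : Continuous h)
    (hfh : ∀ e, f (h e) = f e) (e : E) : h e = e := by
  by_contra hne
  obtain ⟨V, U, hV, hU, heV, heU, hVU⟩ := t2_separation hne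
  have hW : IsOpen (U ∩ h ⁻¹' V) := hU.inter (hV.preimage hh)
  -- Removing `U ∩ h ⁻¹' V` loses no value of `f`: a removed `y` is replaced by `h y`, which lies in
  -- the same fibre and in `V`, hence outside `U`.
  refine hf.2.2 (U ∩ h ⁻¹' V)ᶜ hW.isClosed_compl
    (Set.compl_ne_univ.2 ⟨e, heU, heV⟩) (Set.eq_univ_of_forall fun x => ?_)
  obtain ⟨y, rfl⟩ := hf.2.1 x
  by_cases hy : y ∈ U ∩ h ⁻¹' V
  · exact ⟨h y, fun hhy => hVU.le_bot ⟨hy.2, hhy.1⟩, hfh y⟩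
  · exact ⟨y, hy, rfl⟩

theorem CompactT2.Projective.of_retract {P E : Type u} [TopologicalSpace P] [TopologicalSpace E]
    (hP : CompactT2.Projective P) {i : E → P} {r : P → E} (hi : Continuous i) (hr : Continuous r)
    (hri : ∀ e, r (i e) = e) : CompactT2.Projective E := by
  intro Y Z _ _ _ _ _ _ f g hf hg hs
  obtain ⟨h, hh, hgh⟩ := hP (hf.comp hr) hg hs
  refine ⟨h ∘ i, hh.comp hi, funext fun e => ?_⟩
  have := congrFun hgh (i e)
  simpa [hri] using this

theorem exists_projective_surjection (X : Type u) [TopologicalSpace X] [CompactSpace X]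
    [T2Space X] :
    ∃ (P : Type u) (_ : TopologicalSpace P) (_ : CompactSpace P) (_ : T2Space P) (p : P → X),
      CompactT2.Projective P ∧ Continuous p ∧ p.Surjective := by
  -- `D` is a discrete copy of `X`, kept as a separate type so that the two topologies do not clash;
  -- `P` is its Stone–Čech compactification.
  have key : ∀ (D : Type u) (_ : TopologicalSpace D) (_ : DiscreteTopology D) (g : D → X),
      g.Surjective → ∃ (P : Type u) (_ : TopologicalSpace P) (_ : CompactSpace P) (_ : T2Space P)
        (p : P → X), CompactT2.Projective P ∧ Continuous p ∧ p.Surjective := by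
    intro D _ _ g hg
    have hgc : Continuous g := continuous_of_discreteTopology
    refine ⟨StoneCech D, inferInstance, inferInstance, inferInstance, stoneCechExtend hgc,
      StoneCech.projective, continuous_stoneCechExtend hgc, fun x => ?_⟩
    obtain ⟨d, rfl⟩ := hg x
    exact ⟨stoneCechUnit d, congrFun (stoneCechExtend_extends hgc) d⟩
  exact key X ⊥ (@DiscreteTopology.mk X ⊥ rfl) id Function.surjective_id

/-- Every compact Hausdorff space has a compact Hausdorff absolute. -/
theorem exists_compact_extremallyDisconnected_irreducible (X : Type u) [TopologicalSpace X]
    [CompactSpace X] [T2Space X] :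
    ∃ (E : Type u) (_ : TopologicalSpace E), CompactSpace E ∧ T2Space E ∧
      ExtremallyDisconnected E ∧ ∃ f : E → X, IsIrreducibleMap f := by
  obtain ⟨P, _, _, _, p, hP, hp, hps⟩ := exists_projective_surjection X
  obtain ⟨E, hE, hEs, hEm⟩ := exists_compact_surjective_zorn_subset hp hps
  have hsurj : (E.domRestrict p).Surjective := fun x => by
    obtain ⟨y, hy, rfl⟩ : x ∈ p '' E := hEs ▸ Set.mem_univ x
    exact ⟨⟨y, hy⟩, rfl⟩
  have hcont : Continuous (E.domRestrict p) := hp.comp continuous_subtype_val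
  have hirr : IsIrreducibleMap (E.domRestrict p) := ⟨hcont, hsurj, fun A hA hne => hEm A hne hA⟩
  -- Projectivity lifts `p` through its own restriction to the minimal closed set `E`. By
  -- irreducibility the lift fixes `E` pointwise, so `E` is a retract of `P`.
  obtain ⟨r, hr, hpr⟩ := hP hp hcont hsurj
  have hret : ∀ e : E, r e = e := hirr.eq_id_of_comp_eq (hr.comp continuous_subtype_val)
    fun e => congrFun hpr e
  have hproj : CompactT2.Projective E := hP.of_retract continuous_subtype_val hr hret
  exact ⟨E, inferInstance, hE, inferInstance, hproj.extremallyDisconnected, _, hirr⟩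

/-- `(f '' Uᶜ)ᶜ` consists of the points whose whole fibre lies in `U`; it transfers open sets from
`E` to `X` when `f` is closed. -/
theorem IsIrreducibleMap.compl_image_compl_nonempty {E X : Type*} [TopologicalSpace E]
    [TopologicalSpace X] {f : E → X} (hf : IsIrreducibleMap f) {U : Set E} (hU : IsOpen U)
    (hne : U.Nonempty) : (f '' Uᶜ)ᶜ.Nonempty :=
  Set.nonempty_compl.2 (hf.2.2 _ hU.isClosed_compl (Set.compl_ne_univ.2 hne))

theorem IsIrreducibleMap.isPiBase_preimage {E X : Type*} [TopologicalSpace E]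
    [TopologicalSpace X] {f : E → X} (hf : IsIrreducibleMap f) (hc : IsClosedMap f)
    {B : Set (Set X)} (hB : IsPiBase B) : IsPiBase ((f ⁻¹' ·) '' B) := by
  refine ⟨?_, fun U hU hne => ?_⟩
  · rintro _ ⟨V, hV, rfl⟩
    exact (hB.1 V hV).preimage hf.1
  · obtain ⟨V, hV, hVne, hVU⟩ := hB.2 _ (hc _ hU.isClosed_compl).isOpen_compl
      (hf.compl_image_compl_nonempty hU hne)
    refine ⟨_, ⟨V, hV, rfl⟩, hVne.preimage hf.2.1, fun e he => ?_⟩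
    by_contra heU
    exact hVU he ⟨e, heU, rfl⟩

theorem IsIrreducibleMap.isPiBase_compl_image_compl {E X : Type*} [TopologicalSpace E]
    [TopologicalSpace X] {f : E → X} (hf : IsIrreducibleMap f) (hc : IsClosedMap f)
    {B : Set (Set E)} (hB : IsPiBase B) : IsPiBase ((fun V => (f '' Vᶜ)ᶜ) '' B) := by
  refine ⟨?_, fun U hU hne => ?_⟩
  · rintro _ ⟨V, hV, rfl⟩
    exact (hc _ (hB.1 V hV).isClosed_compl).isOpen_compl
  · obtain ⟨V, hV, hVne, hVU⟩ := hB.2 _ (hU.preimage hf.1) (hne.preimage hf.2.1)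
    refine ⟨_, ⟨V, hV, rfl⟩, hf.compl_image_compl_nonempty (hB.1 V hV) hVne, fun x hx => ?_⟩
    obtain ⟨e, rfl⟩ := hf.2.1 x
    by_contra heU
    exact hx ⟨e, fun he => heU (hVU he), rfl⟩

theorem IsTopologicalBasis.isPiBase {X : Type*} [TopologicalSpace X] {B : Set (Set X)}
    (hB : IsTopologicalBasis B) : IsPiBase B := by
  refine ⟨fun V hV => hB.isOpen hV, fun U hU ⟨x, hx⟩ => ?_⟩
  obtain ⟨V, hV, hxV, hVU⟩ := hB.exists_subset_of_mem_open hx hU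
  exact ⟨V, hV, ⟨x, hxV⟩, hVU⟩

theorem exists_isTopologicalBasis_mk_eq_topWeight (X : Type u) [TopologicalSpace X] :
    ∃ B : Set (Set X), IsTopologicalBasis B ∧ #B = topWeight X :=
  csInf_mem (s := {c : Cardinal.{u} | ∃ B : Set (Set X), IsTopologicalBasis B ∧ #B = c})
    ⟨_, _, isTopologicalBasis_opens, rfl⟩

theorem exists_isPiBase_mk_eq_piWeight (X : Type u) [TopologicalSpace X] :
    ∃ B : Set (Set X), IsPiBase B ∧ #B = piWeight X :=
  csInf_mem (s := {c : Cardinal.{u} | ∃ B : Set (Set X), IsPiBase B ∧ #B = c})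
    ⟨_, _, IsTopologicalBasis.isPiBase isTopologicalBasis_opens, rfl⟩

theorem IsTopologicalBasis.topWeight_le {X : Type u} [TopologicalSpace X] {B : Set (Set X)}
    (hB : IsTopologicalBasis B) : topWeight X ≤ #B :=
  csInf_le' ⟨B, hB, rfl⟩

theorem IsPiBase.piWeight_le {X : Type u} [TopologicalSpace X] {B : Set (Set X)}
    (hB : IsPiBase B) : piWeight X ≤ #B :=
  csInf_le' ⟨B, hB, rfl⟩

theorem piWeight_le_topWeight (X : Type u) [TopologicalSpace X] : piWeight X ≤ topWeight X := by
  obtain ⟨B, hB, hcard⟩ := exists_isTopologicalBasis_mk_eq_topWeight X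
  exact hcard ▸ (IsTopologicalBasis.isPiBase hB).piWeight_le

/-- Closed irreducible maps preserve the π-weight. -/
theorem IsIrreducibleMap.piWeight_eq {E X : Type u} [TopologicalSpace E] [TopologicalSpace X]
    {f : E → X} (hf : IsIrreducibleMap f) (hc : IsClosedMap f) : piWeight E = piWeight X := by
  apply le_antisymm
  · obtain ⟨B, hB, hcard⟩ := exists_isPiBase_mk_eq_piWeight X
    exact hcard ▸ (hf.isPiBase_preimage hc hB).piWeight_le.trans mk_image_le
  · obtain ⟨B, hB, hcard⟩ := exists_isPiBase_mk_eq_piWeight E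
    exact hcard ▸ (hf.isPiBase_compl_image_compl hc hB).piWeight_le.trans mk_image_le

theorem Homeomorph.isIrreducibleMap {E X : Type*} [TopologicalSpace E] [TopologicalSpace X]
    (h : E ≃ₜ X) : IsIrreducibleMap h := by
  refine ⟨h.continuous, h.surjective, fun A _ hne hA => hne ?_⟩
  rw [← Set.preimage_image_eq A h.injective, hA, Set.preimage_univ]

theorem CoAbsolute.piWeight_eq {X Y : Type u} [TopologicalSpace X] [TopologicalSpace Y]
    (h : CoAbsolute X Y) : piWeight X = piWeight Y := by
  obtain ⟨E, _, F, _, ⟨_, _, f, hf, hfi⟩, ⟨_, _, g, hg, hgi⟩, ⟨e⟩⟩ := h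
  rw [← hfi.piWeight_eq hf.isClosedMap, ← hgi.piWeight_eq hg.isClosedMap]
  exact e.isIrreducibleMap.piWeight_eq e.isClosedMap

theorem IsIrreducibleMap.isAbsolute {E X : Type*} [TopologicalSpace E] [TopologicalSpace X]
    [CompactSpace E] [T2Space E] [ExtremallyDisconnected E] [T2Space X] {f : E → X}
    (hf : IsIrreducibleMap f) : IsAbsolute E X :=
  ⟨inferInstance, inferInstance, f, hf.1.isProperMap, hf⟩

/-- The topology generated by a family of sets has a base of cardinality at most that of the
family, or countable. -/
theorem topWeight_le_of_generateFrom {Y ι : Type u} [t : TopologicalSpace Y] (s : ι → Set Y)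
    (h : t = generateFrom (Set.range s)) : topWeight Y ≤ max ℵ₀ #ι := by
  refine (IsTopologicalBasis.topWeight_le (isTopologicalBasis_of_subbasis h)).trans ?_
  -- Finite intersections of subbasic sets are indexed by lists, which are easy to count.
  refine le_trans (mk_le_mk_of_subset (t := Set.range fun l : List ι => ⋂ i ∈ l, s i) ?_)
    (mk_range_le.trans (mk_list_le_max ι))
  rintro _ ⟨F, ⟨hF, hFs⟩, rfl⟩
  classical
  rw [← hF.coe_toFinset, ← Set.image_univ, Finset.subset_set_image_iff] at hFs
  obtain ⟨T, -, hT⟩ := hFs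
  refine ⟨T.toList, ?_⟩
  rw [← hF.coe_toFinset, ← hT, Finset.coe_image]
  simp [Set.sInter_image]

/-- A π-base of `X` gives a co-absolute of `X` inside the corresponding Cantor cube. -/
theorem IsPiBase.exists_zeroDimensional_coAbsolute {X : Type u} [TopologicalSpace X]
    [CompactSpace X] [T2Space X] {B : Set (Set X)} (hB : IsPiBase B) :
    ∃ (Y : Type u) (_ : TopologicalSpace Y), CompactSpace Y ∧ T2Space Y ∧
      IsZeroDimensional Y ∧ topWeight Y ≤ max ℵ₀ #B ∧ CoAbsolute X Y := by
  classical
  obtain ⟨E, _, _, _, _, f, hf⟩ := exists_compact_extremallyDisconnected_irreducible X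
  have hclopen : ∀ V : B, IsClopen (closure (f ⁻¹' V)) := fun V =>
    ⟨isClosed_closure, ExtremallyDisconnected.open_closure _ ((hB.1 V V.2).preimage hf.1)⟩
  let g : E → B → Bool := fun e V => decide (e ∈ closure (f ⁻¹' (V : Set X)))
  have hg : Continuous g := continuous_pi fun V => by
    rw [continuous_bool_rng true]
    convert hclopen V
    ext e
    simp [g]
  have hc : CompactSpace (Set.range g) := isCompact_iff_compactSpace.1 (isCompact_range hg)
  have hirr : IsIrreducibleMap (Set.rangeFactorization g) := by
    refine ⟨hg.subtype_mk _, Set.rangeFactorization_surjective, fun A hA hne himg => ?_⟩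
    obtain ⟨e, he⟩ := (Set.ne_univ_iff_exists_notMem A).1 hne
    -- `U` is taken closed so that it contains the closure of any `f ⁻¹' V` inside its interior. The
    -- coordinate `V` then separates the points of `f ⁻¹' V` from `A`.
    obtain ⟨U, ⟨hUn, hUc⟩, hUA⟩ :=
      (closed_nhds_basis e).mem_iff.1 (hA.isOpen_compl.mem_nhds he)
    obtain ⟨_, ⟨V, hV, rfl⟩, ⟨d, hd⟩, hVU⟩ := (hf.isPiBase_preimage hf.1.isClosedMap hB).2
      (interior U) isOpen_interior ⟨e, mem_interior_iff_mem_nhds.2 hUn⟩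
    obtain ⟨a, ha, had⟩ : Set.rangeFactorization g d ∈ Set.rangeFactorization g '' A :=
      himg ▸ Set.mem_univ _
    have hgad : g a ⟨V, hV⟩ = g d ⟨V, hV⟩ := congrFun (congrArg Subtype.val had) _
    have hda : d ∈ closure (f ⁻¹' V) := subset_closure hd
    have haV : a ∈ closure (f ⁻¹' V) := by simpa [g, hda] using hgad
    exact hUA (closure_minimal (hVU.trans interior_subset) hUc haV) ha
  refine ⟨Set.range g, inferInstance, hc, inferInstance, isTopologicalBasis_isClopen, ?_,
    E, inferInstance, E, inferInstance, hf.isAbsolute, hirr.isAbsolute, ⟨Homeomorph.refl E⟩⟩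
  refine (topWeight_le_of_generateFrom
    (fun p : B × Bool => {y : Set.range g | y.1 p.1 = p.2}) ?_).trans ?_
  · refine le_antisymm (le_generateFrom ?_) ?_
    · rintro _ ⟨p, rfl⟩
      have hp : Continuous fun y : Set.range g => y.1 p.1 :=
        (continuous_apply p.1).comp continuous_subtype_val
      exact continuous_discrete_rng.1 hp p.2
    -- The subspace topology is the coarsest one making all coordinates continuous.
    · have hle : ∀ T : TopologicalSpace (Set.range g),
          (∀ (V : B) (b : Bool), @IsOpen _ T {y | y.1 V = b}) →
            T ≤ instTopologicalSpaceSubtype := fun T hT =>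
        continuous_iff_le_induced.1
          (continuous_pi fun V => continuous_discrete_rng.2 fun b => hT V b)
      exact hle _ fun V b => isOpen_generateFrom_of_mem ⟨(V, b), rfl⟩
  · have h2 : #(B × Bool) ≤ max (max #B 2) ℵ₀ := by
      simpa using mul_le_max #B 2
    refine max_le (le_max_left _ _) (h2.trans (max_le (max_le (le_max_right _ _) ?_)
      (le_max_left _ _)))
    exact (ofNat_lt_aleph0 (n := 2)).le.trans (le_max_left _ _)

theorem theorem4 (X : Type u) [TopologicalSpace X] [CompactSpace X] [T2Space X] :
    (∀ τ : Cardinal.{u}, ℵ₀ ≤ τ → piWeight X = τ →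
      ∃ (Y : Type u) (_ : TopologicalSpace Y), CompactSpace Y ∧ T2Space Y ∧
        IsZeroDimensional Y ∧ topWeight Y = τ ∧ CoAbsolute X Y) ∧
    ((∃ (Y : Type u) (_ : TopologicalSpace Y), CompactSpace Y ∧ MetrizableSpace Y ∧
        CoAbsolute X Y) ↔ piWeight X ≤ ℵ₀) := by
  obtain ⟨B, hB, hcard⟩ := exists_isPiBase_mk_eq_piWeight X
  obtain ⟨Y, _, _, _, hY0, hYw, hXY⟩ := hB.exists_zeroDimensional_coAbsolute
  rw [hcard] at hYw
  refine ⟨?_, ?_, fun hle => ?_⟩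
  · rintro τ hτ rfl
    refine ⟨Y, inferInstance, inferInstance, inferInstance, hY0, le_antisymm ?_ ?_, hXY⟩
    · rwa [max_eq_right hτ] at hYw
    · exact hXY.piWeight_eq ▸ piWeight_le_topWeight Y
  · rintro ⟨Z, _, _, _, hXZ⟩
    let := metrizableSpaceMetric Z
    rw [hXZ.piWeight_eq]
    refine (piWeight_le_topWeight Z).trans
      ((IsTopologicalBasis.topWeight_le (isBasis_countableBasis Z)).trans ?_)
    exact (countable_countableBasis Z).le_aleph0
  · rw [max_eq_left hle] at hYw
    obtain ⟨C, hC, hCcard⟩ := exists_isTopologicalBasis_mk_eq_topWeight Y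
    have : SecondCountableTopology Y :=
      hC.secondCountableTopology (le_aleph0_iff_set_countable.1 (hCcard ▸ hYw))
    exact ⟨Y, inferInstance, inferInstance, metrizableSpace_of_t3_secondCountable Y, hXY⟩
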